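/- \textbf{Setting.} Use complex coordinates $x=u+iv$, $y=\bar x=u-iv$ on $\mathbb{R}^2$. Let $$X=X_{lin}+\sum_{r=2}^{d}\bigl(P_r\,\partial_x+Q_r\,\partial_y\bigr),\qquad X_{lin}=i(x\partial_x-y\partial_y),$$ be a real Hamiltonian polynomial vector field, with $P_r,Q_r\in\mathbb{C}[x,y]$ homogeneous of degree $r$. This means that the $\partial_y$-component of $X$ is the conjugate of its $\partial_x$-component (coefficients conjugated and $x,y$ exchanged), and that $X=2i\,\frac{\partial H}{\partial y}\,\partial_x-2i\,\frac{\partial H}{\partial x}\,\partial_y$ for a polynomial $H\in\mathbb{C}[x,y]$ that is real on $y=\bar x$. \textbf{Words.} The alphabet is $A(X)=\bigcup_{r=2}^{d}\{(r,-1),(-1,r)\}\cup\{(k-1,r-k):1\le k\le r\}$. Write $X=X_{lin}+\sum_{n\in A(X)}B_n$ with $B_n=x^{n^1}y^{n^2}(p_n\,x\partial_x+q_n\,y\partial_y)$ for $n=(n^1,n^2)$ (with $q_n=0$ if $n^1=-1$ and $p_n=0$ if $n^2=-1$). A letter $n$ has weight $\omega(n)=i(n^1-n^2)$ and depth $p(n)=n^1+n^2$.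 Both are extended additively to the set $A^*(X)$ of all words $\mathbf n=n_1\cdots n_r$, and $\mathbf n$ is resonant if $\omega(\mathbf n)=0$. Put $B_{\mathbf n}=B_{n_1}\circ\cdots\circ B_{n_r}$ (as differential operators on $\mathbb{C}[x,y]$) and $[B_{\mathbf n}]=[\dots[[B_{n_1},B_{n_2}],B_{n_3}],\dots,B_{n_r}]$, with $[B_\emptyset]=0$. \textbf{Correction.} The correction mould is $Carr^{\mathbf n}=C(\omega(n_1),\dots,\omega(n_r))$, where $C(\emptyset)=0$; $C(z)=1$ if $z=0$ and $C(z)=0$ otherwise; and, for $r\ge2$, $C(z_1,\dots,z_r)=0$ if $z_1=0$, while for $z_1\ne0$ it is given recursively by $$z_1\,C(z_1,\dots,z_r)+C(z_1+z_2,z_3,\dots,z_r)=\sum_{\mathbf b\mathbf c=z_2\cdots z_r}C(z_1\mathbf c)\,C(\mathbf b).$$ The component of depth $q$ of the correction is the finite sum $Carr_q(X)=\sum_{\mathbf n\in A^*(X),\,p(\mathbf n)=q}Carr^{\mathbf n}B_{\mathbf n}$. Independently of this expansion, a formal vector field $Z$ without constant and linear terms is called a correction of $X$ if $X-Z$ is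 formally conjugate to $X_{lin}$ and $[X_{lin},Z]=0$; its part of depth $q$ is its homogeneous part of degree $q+1$. \textbf{Theorem.} For every $X$ as above: \begin{enumerate} \item $Carr_{2p+1}(X)=0$ for every integer $p\ge0$; \item if $Z$ is a correction of $X$, then its part of depth $2p+1$ is zero for every integer $p\ge0$; \item every resonant word $\mathbf n\in A^*(X)$ has even depth $p(\mathbf n)\ge 0$, and there are constants $P_{\mathbf n},Q_{\mathbf n}\in\mathbb{C}$ with $[B_{\mathbf n}]=(xy)^{p(\mathbf n)/2}\,(P_{\mathbf n}\,x\partial_x+Q_{\mathbf n}\,y\partial_y)$. \end{enumerate} -/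

import Mathlib

/-! Planar polynomial vector fields in the complex coordinates `x = u + i v`, `y = u - i v`. -/

noncomputable section

namespace Correction

/-- A polynomial vector field `P ∂x + Q ∂y` on `ℂ²`, stored as the pair `(P, Q)`. The variable of
index `0` is `x` and the variable of index `1` is `y`. -/
abbrev PolyField : Type := Fin 2 → MvPolynomial (Fin 2) ℂ

/-- A formal vector field on `ℂ²` at the origin, stored as its pair of components. -/
abbrev FormalField : Type := Fin 2 → MvPowerSeries (Fin 2) ℂ

/-- Derivations of `ℂ[x, y]`; they carry the usual Lie bracket `⁅D, E⁆ = D ∘ E - E ∘ D`. -/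
abbrev Der : Type := Derivation ℂ (MvPolynomial (Fin 2) ℂ) (MvPolynomial (Fin 2) ℂ)

/-- The derivation `P ∂x + Q ∂y` defined by a polynomial vector field. -/
def toDer (X : PolyField) : Der := MvPolynomial.mkDerivation ℂ X

/-- The linear centre `X_lin = i (x ∂x - y ∂y)`. -/
def linField : PolyField :=
  ![MvPolynomial.C Complex.I * MvPolynomial.X 0, -(MvPolynomial.C Complex.I * MvPolynomial.X 1)]

/-- `X = X_lin + (terms of degree at least two)`. -/
def HasLinearPart (X : PolyField) : Prop :=
  ∀ j : Fin 2, MvPolynomial.homogeneousComponent 0 (X j) = 0 ∧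
    MvPolynomial.homogeneousComponent 1 (X j) = linField j

/-- `F(x, y) ↦ conj(F)(y, x)`: conjugate the coefficients and exchange the two variables. On the
real plane `y = conj x` this is the complex conjugation of the values of `F`. -/
def conjSwap (F : MvPolynomial (Fin 2) ℂ) : MvPolynomial (Fin 2) ℂ :=
  MvPolynomial.rename (Equiv.swap (0 : Fin 2) 1) (MvPolynomial.map (starRingEnd ℂ) F)

/-- The field `P ∂x + Q ∂y` is the complex form of a real planar field: `Q` is conjugate to `P`. -/
def IsReal (X : PolyField) : Prop := X 1 = conjSwap (X 0)

/-- The field `P ∂x + Q ∂y` is the complex form of a real polynomial Hamiltonian field. In the real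
coordinates `x = u + i v` the system `u' = -∂H/∂v`, `v' = ∂H/∂u` reads `x' = 2 i ∂H/∂y`,
`y' = -2 i ∂H/∂x` with `y = conj x`, and `H` takes real values on the real plane. -/
def IsRealHamiltonian (X : PolyField) : Prop :=
  IsReal X ∧ ∃ H : MvPolynomial (Fin 2) ℂ, conjSwap H = H ∧
    X 0 = MvPolynomial.C (2 * Complex.I) * MvPolynomial.pderiv 1 H ∧
    X 1 = -(MvPolynomial.C (2 * Complex.I) * MvPolynomial.pderiv 0 H)

/-! ### Alphabet, prepared form, words -/

/-- Letters are degrees `n = (n¹, n²)` of homogeneous differential operators. -/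
abbrev Letter : Type := ℤ × ℤ

/-- The letters `(r,-1)`, `(-1,r)` and `(k-1,r-k)`, `1 ≤ k ≤ r`, of a component of degree `r`. -/
def alphabetOfDegree (r : ℕ) : Finset Letter :=
  insert ((r : ℤ), (-1 : ℤ)) (insert ((-1 : ℤ), (r : ℤ))
    ((Finset.Icc 1 r).image fun k : ℕ => ((k : ℤ) - 1, (r : ℤ) - (k : ℤ))))

/-- The degree of a polynomial vector field. -/
def degree (X : PolyField) : ℕ := max (X 0).totalDegree (X 1).totalDegree

/-- The alphabet `A(X)`: the union of the alphabets of the components of degree `2, …, deg X`. -/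
def alphabet (X : PolyField) : Finset Letter :=
  (Finset.Icc 2 (degree X)).biUnion alphabetOfDegree

/-- The exponent of the monomial `x^a y^b`. -/
def expo (a b : ℕ) : Fin 2 →₀ ℕ := Finsupp.single 0 a + Finsupp.single 1 b

/-- The term of `F` in `x^a y^b`, which is zero when one of the exponents is negative. -/
def term (F : MvPolynomial (Fin 2) ℂ) (a b : ℤ) : MvPolynomial (Fin 2) ℂ :=
  if 0 ≤ a ∧ 0 ≤ b then
    MvPolynomial.monomial (expo a.toNat b.toNat) (F.coeff (expo a.toNat b.toNat))
  else 0

/-- The homogeneous operator `B_n = x^(n¹) y^(n²) (p_n x ∂x + q_n y ∂y)` of the prepared form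
`X = X_lin + ∑ B_n`: the part of `X` with term in `x^(n¹+1) y^(n²)` along `∂x` and term in
`x^(n¹) y^(n²+1)` along `∂y`. -/
def B (X : PolyField) (n : Letter) : Der :=
  toDer ![term (X 0) (n.1 + 1) n.2, term (X 1) n.1 (n.2 + 1)]

/-- Words over the letters, with the empty word. -/
abbrev Word : Type := List Letter

/-- `w ∈ A*(X)`. -/
def IsWordOf (X : PolyField) (w : Word) : Prop := ∀ n ∈ w, n ∈ alphabet X

/-- The operator `B_w = B_{n₁} ∘ ⋯ ∘ B_{n_r}`, an endomorphism of `ℂ[x, y]`. -/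
def BWord (X : PolyField) (w : Word) : Module.End ℂ (MvPolynomial (Fin 2) ℂ) :=
  (w.map fun n => ((B X n : Der) : Module.End ℂ (MvPolynomial (Fin 2) ℂ))).prod

/-- The nested bracket `[B_w] = [… [[B_{n₁}, B_{n₂}], B_{n₃}], …, B_{n_r}]`, zero for the empty
word. -/
def bracketWord (X : PolyField) : Word → Der
  | [] => 0
  | n :: w => w.foldl (fun D m => ⁅D, B X m⁆) (B X n)

/-- The weight `ω(n) = ⟨n, λ⟩` for the eigenvalues `λ = (i, -i)` of `X_lin`. -/
def weight (n : Letter) : ℂ := (n.1 : ℂ) * Complex.I + (n.2 : ℂ) * (-Complex.I)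

/-- The weight of a word is the sum of the weights of its letters. -/
def weightWord (w : Word) : ℂ := (w.map weight).sum

/-- A word is resonant when its weight vanishes. -/
def IsResonant (w : Word) : Prop := weightWord w = 0

/-- The depth of a word, the sum of `n¹ + n² = deg B_n - 1` over its letters. -/
def depth (w : Word) : ℤ := (w.map fun n => n.1 + n.2).sum

/-- The derivation `(xy)^m (P x ∂x + Q y ∂y)`. -/
def resonantDer (m : ℕ) (P Q : ℂ) : Der :=
  toDer ![(MvPolynomial.X 0 * MvPolynomial.X 1) ^ m * (MvPolynomial.C P * MvPolynomial.X 0),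
    (MvPolynomial.X 0 * MvPolynomial.X 1) ^ m * (MvPolynomial.C Q * MvPolynomial.X 1)]

/-! ### The mould of the correction and the components of the correction -/

/-- The universal values `C_r(z₁, …, z_r)` of the mould of the correction, computed by recursion on
the length: the value at `∅` is `0`, the value at `z` is `1` if `z = 0` and `0` otherwise, and a
word of length at least two beginning with a zero weight has value `0`. If `z₁ ≠ 0` the value is
given by the variance formula
`z₁ C(z₁,…,z_r) + C(z₁+z₂,z₃,…,z_r) = ∑ C(z₁ 𝐜) C(𝐛)`, the sum being over `𝐛𝐜 = z₂⋯z_r`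
(the term with `𝐛 = ∅` vanishes). -/
def carrUniv : List ℂ → ℂ
  | [] => 0
  | [z] => if z = 0 then 1 else 0
  | z₁ :: z₂ :: t =>
    if z₁ = 0 then 0
    else
      ((∑ k : Fin (t.length + 1),
          carrUniv (z₁ :: (z₂ :: t).drop (k.val + 1)) * carrUniv ((z₂ :: t).take (k.val + 1)))
        - carrUniv ((z₁ + z₂) :: t)) / z₁
termination_by l => l.length
decreasing_by
  all_goals
    simp only [List.length_cons, List.length_drop, List.length_take]
    omega

/-- The mould `Carr^w` of the correction. -/
def carrMould (w : Word) : ℂ := carrUniv (w.map weight)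

theorem depth_pos_of_mem_alphabet {X : PolyField} {n : Letter} (hn : n ∈ alphabet X) :
    1 ≤ n.1 + n.2 := by
  simp only [alphabet, alphabetOfDegree, Finset.mem_biUnion, Finset.mem_Icc, Finset.mem_insert,
    Finset.mem_image] at hn
  obtain ⟨r, ⟨hr, -⟩, h | h | ⟨k, -, h⟩⟩ := hn <;> subst h <;> dsimp only <;> omega

theorem length_le_depth {X : PolyField} {w : Word} (hw : IsWordOf X w) :
    (w.length : ℤ) ≤ depth w := by
  induction w with
  | nil => simp [depth]
  | cons n t ih =>
    have h1 := depth_pos_of_mem_alphabet (hw n (by simp))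
    have h2 := ih fun m hm => hw m (by simp [hm])
    simp only [depth, List.map_cons, List.sum_cons, List.length_cons] at h2 ⊢
    push_cast
    linarith

/-- Only finitely many words of `A*(X)` have a given depth. -/
theorem finite_wordsOfDepth (X : PolyField) (d : ℕ) :
    {w : Word | IsWordOf X w ∧ depth w = (d : ℤ)}.Finite := by
  have hf : {l : List {n // n ∈ alphabet X} | l.length ≤ d}.Finite :=
    List.finite_length_le _ d
  refine (hf.image (List.map Subtype.val)).subset ?_
  rintro w ⟨hw, hd⟩
  refine ⟨w.attach.map fun m => ⟨m.1, hw m.1 m.2⟩, ?_, ?_⟩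
  · have := length_le_depth hw
    change (w.attach.map _).length ≤ d
    rw [List.length_map, List.length_attach]
    omega
  · rw [List.map_map]
    exact List.attach_map_subtype_val w

/-- The finite set of the words of `A*(X)` of depth `d`. -/
def wordsOfDepth (X : PolyField) (d : ℕ) : Finset Word := (finite_wordsOfDepth X d).toFinset

/-- The component of depth `d` of the correction,
`Carr_d(X) = ∑ Carr^w B_w` over the words `w ∈ A*(X)` of depth `d`. -/
def carr (X : PolyField) (d : ℕ) : Module.End ℂ (MvPolynomial (Fin 2) ℂ) :=
  ∑ w ∈ wordsOfDepth X d, carrMould w • BWord X w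

/-! ### The correction as the solution of a conjugacy problem -/

/-- A polynomial vector field seen as a formal one. -/
def toFormal (X : PolyField) : FormalField := fun j => (X j : MvPowerSeries (Fin 2) ℂ)

/-- The action `X f = X₀ ∂f/∂x + X₁ ∂f/∂y` of a formal vector field on a formal series. -/
def act (X : FormalField) (f : MvPowerSeries (Fin 2) ℂ) : MvPowerSeries (Fin 2) ℂ :=
  ∑ j : Fin 2, X j * MvPowerSeries.pderiv ℂ j f

/-- The Lie bracket of two formal vector fields. -/
def formalBracket (X Y : FormalField) : FormalField := fun j => act X (Y j) - act Y (X j)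

/-- `φ` is a formal change of coordinates at the origin: it fixes the origin and its linear part is
invertible. -/
def IsFormalChange (φ : FormalField) : Prop :=
  (∀ j, MvPowerSeries.constantCoeff (φ j) = 0) ∧
    IsUnit (Matrix.of fun j k : Fin 2 => MvPowerSeries.coeff (Finsupp.single k 1) (φ j)).det

/-- Two formal vector fields are formally conjugate: a formal change of coordinates `φ` maps `Y`
to `X`, that is `Dφ · Y = X ∘ φ`. -/
def FormallyConjugate (X Y : FormalField) : Prop :=
  ∃ φ : FormalField, IsFormalChange φ ∧ ∀ j, act Y (φ j) = MvPowerSeries.subst φ (X j)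

/-- `Z` is a correction of `X`: it has no constant and no linear term (so that `X - Z` has the same
linear part as `X`), `X - Z` is formally conjugate to `X_lin`, and `[X_lin, Z] = 0`. -/
def IsCorrection (X : PolyField) (Z : FormalField) : Prop :=
  (∀ (j : Fin 2) (e : Fin 2 →₀ ℕ), e.degree ≤ 1 → MvPowerSeries.coeff e (Z j) = 0) ∧
    FormallyConjugate (toFormal X - Z) (toFormal linField) ∧
    formalBracket (toFormal linField) Z = 0

/-- The homogeneous part of depth `d`, that is of degree `d + 1`, of a formal vector field. -/
def depthPart (Z : FormalField) (d : ℕ) : FormalField := fun j =>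
  (MvPowerSeries.homogeneousComponent (d + 1) (Z j) : MvPowerSeries (Fin 2) ℂ)

end Correction

end

namespace Correction

/-! ### The mould of the correction vanishes on words of nonzero weight -/

/-! All three claims rest on one parity: a word whose letters sum to `(a, b)` has weight `i (a - b)`
and depth `a + b`, so weight zero forces even depth. The mould vanishes on words of nonzero weight
(`carrUniv_eq_zero_of_sum_ne_zero`), which kills every summand of odd depth. On formal fields, `ad
X_lin` is diagonal on monomial fields, and its eigenvalues in odd depth are odd multiples of `i`, so
its kernel has only even depths (`coeff_eq_zero_of_formalBracket_eq_zero`). For brackets, bidegrees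
add up (`IsBihomogeneous.bracket`), so a resonant word yields bidegree `(m, m)`; there a derivation
is fixed by one coefficient along each variable (`IsBihomogeneous.eq_resonantDer`). -/

/-- The recursion respects total weight: merging `z₁` and `z₂` keeps the sum, and the weights of the
two factors `z₁ 𝐜` and `𝐛` add up to it, so one of them is nonzero. All these words are shorter,
hence strong induction on the length. -/
theorem carrUniv_eq_zero_of_sum_ne_zero (l : List ℂ) (h : l.sum ≠ 0) : carrUniv l = 0 := by
  induction hn : l.length using Nat.strong_induction_on generalizing l with
  | _ n ih =>
    match l with
    | [] => simp at h
    | [z] =>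
      rw [carrUniv, if_neg (by simpa using h)]
    | z₁ :: z₂ :: t =>
      rw [carrUniv]
      split_ifs with hz
      · rfl
      · have hlast : carrUniv ((z₁ + z₂) :: t) = 0 :=
          ih (t.length + 1) (by simp [← hn]) _ (by simpa [add_assoc] using h) rfl
        rw [hlast, sub_zero, Finset.sum_eq_zero, zero_div]
        intro k _
        by_cases hb : ((z₂ :: t).take (k.val + 1)).sum = 0
        · have hc : (z₁ :: (z₂ :: t).drop (k.val + 1)).sum ≠ 0 := by
            intro hc
            apply h
            rw [List.sum_cons] at hc ⊢
            rw [← List.sum_take_add_sum_drop (z₂ :: t) (k.val + 1), hb, zero_add, hc]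
          rw [ih _ (by simp only [List.length_cons, List.length_drop] at hn ⊢; omega) _ hc rfl,
            zero_mul]
        · rw [ih _ (by simp only [List.length_cons, List.length_take] at hn ⊢; omega) _ hb rfl,
            mul_zero]

/-! ### Resonance and parity of the depth -/

theorem weightWord_eq (w : Word) :
    weightWord w = (((w.sum.1 - w.sum.2 : ℤ)) : ℂ) * Complex.I := by
  induction w with
  | nil => simp [weightWord]
  | cons n t ih =>
    simp only [weightWord, List.map_cons, List.sum_cons] at ih ⊢
    rw [ih]
    simp only [weight, Prod.fst_add, Prod.snd_add]
    push_cast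
    ring

theorem isResonant_iff (w : Word) : IsResonant w ↔ w.sum.1 = w.sum.2 := by
  rw [IsResonant, weightWord_eq, mul_eq_zero, or_iff_left Complex.I_ne_zero, Int.cast_eq_zero,
    sub_eq_zero]

theorem depth_eq (w : Word) : depth w = w.sum.1 + w.sum.2 := by
  induction w with
  | nil => simp [depth]
  | cons n t ih =>
    simp only [depth, List.map_cons, List.sum_cons, Prod.fst_add, Prod.snd_add] at ih ⊢
    rw [ih]
    ring

theorem carrMould_eq_zero_of_not_isResonant {w : Word} (hw : ¬ IsResonant w) :
    carrMould w = 0 :=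
  carrUniv_eq_zero_of_sum_ne_zero _ hw

theorem carr_odd (X : PolyField) (p : ℕ) : carr X (2 * p + 1) = 0 := by
  refine Finset.sum_eq_zero fun w hw => ?_
  have hd : depth w = ((2 * p + 1 : ℕ) : ℤ) := by
    simpa using ((finite_wordsOfDepth X (2 * p + 1)).mem_toFinset.1 hw).2
  rw [carrMould_eq_zero_of_not_isResonant, zero_smul]
  rw [isResonant_iff]
  rw [depth_eq] at hd
  omega

/-! ### Formal fields commuting with the linear centre -/

section Formal

open MvPowerSeries

/-- Monomials are eigenvectors of the Euler operators `x ∂x` and `y ∂y`, which makes `X_lin`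
diagonal. -/
theorem coeff_X_mul_pderiv (i : Fin 2) (f : MvPowerSeries (Fin 2) ℂ) (e : Fin 2 →₀ ℕ) :
    coeff e (X i * pderiv ℂ i f) = (e i : ℂ) * coeff e f := by
  classical
  rw [X, coeff_monomial_mul]
  split_ifs with h
  · have hi : 1 ≤ e i := by simpa using h i
    rw [coeff_pderiv, tsub_add_cancel_of_le h, Finsupp.tsub_apply, Finsupp.single_eq_same,
      Nat.cast_sub hi]
    push_cast
    ring
  · have hi : e i = 0 := by
      by_contra hi
      exact h (Finsupp.single_le_iff.2 (Nat.one_le_iff_ne_zero.2 hi))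
    simp [hi]

theorem toFormal_linField_zero : toFormal linField 0 = C Complex.I * X 0 := by
  simp [toFormal, linField]

theorem toFormal_linField_one : toFormal linField 1 = -(C Complex.I * X 1) := by
  apply MvPowerSeries.ext
  intro e
  simp [toFormal, linField, ← MvPolynomial.coe_X, ← MvPolynomial.coe_C, ← MvPolynomial.coe_mul,
    MvPolynomial.coeff_coe]

theorem coeff_act_linField (f : MvPowerSeries (Fin 2) ℂ) (e : Fin 2 →₀ ℕ) :
    coeff e (act (toFormal linField) f) = Complex.I * ((e 0 : ℂ) - e 1) * coeff e f := by
  rw [act, Fin.sum_univ_two, toFormal_linField_zero, toFormal_linField_one, neg_mul, mul_assoc,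
    mul_assoc, map_add, map_neg, coeff_C_mul, coeff_C_mul, coeff_X_mul_pderiv,
    coeff_X_mul_pderiv]
  ring

theorem pderiv_C_mul_X (i j : Fin 2) (a : ℂ) :
    pderiv ℂ i (C a * X j : MvPowerSeries (Fin 2) ℂ) = if i = j then C a else 0 := by
  rw [Derivation.leibniz, pderiv_C, smul_zero, add_zero]
  split_ifs with h
  · rw [h, pderiv_X_self, smul_eq_mul, mul_one]
  · rw [pderiv_X_of_ne (Ne.symm h), smul_zero]

theorem act_linField_zero (Z : FormalField) :
    act Z (toFormal linField 0) = C Complex.I * Z 0 := by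
  rw [act, Fin.sum_univ_two, toFormal_linField_zero, pderiv_C_mul_X, pderiv_C_mul_X]
  simp [mul_comm]

theorem act_linField_one (Z : FormalField) :
    act Z (toFormal linField 1) = -(C Complex.I * Z 1) := by
  rw [act, Fin.sum_univ_two, toFormal_linField_one, map_neg, map_neg, pderiv_C_mul_X,
    pderiv_C_mul_X]
  simp [mul_comm]

/-- A field commuting with the linear centre has only monomials `x^(m+1) y^m ∂x` and
`x^m y^(m+1) ∂y`; in particular its terms have odd degree. -/
theorem coeff_eq_zero_of_formalBracket_eq_zero {Z : FormalField}
    (hZ : formalBracket (toFormal linField) Z = 0) (j : Fin 2) {e : Fin 2 →₀ ℕ}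
    (he : Even (e 0 + e 1)) : coeff e (Z j) = 0 := by
  have h : coeff e (formalBracket (toFormal linField) Z j) = 0 := by
    rw [hZ]
    exact map_zero _
  rw [formalBracket, map_sub, coeff_act_linField] at h
  obtain ⟨k, hk⟩ := he
  -- The eigenvalues of `ad X_lin` on `x^a y^b ∂x` and `x^a y^b ∂y` are `i (a - b - s)` with `s = 1`
  -- and `s = -1`. For `a + b` even, `a - b - s` is odd, hence nonzero.
  have key : ∀ s : ℤ, Odd s → Complex.I * (((e 0 : ℂ) - e 1) - s) ≠ 0 := by
    intro s ⟨t, ht⟩ h0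
    rcases mul_eq_zero.1 h0 with h0 | h0
    · exact Complex.I_ne_zero h0
    · have : (e 0 : ℤ) - e 1 - s = 0 := by exact_mod_cast h0
      omega
  match j with
  | 0 =>
    rw [act_linField_zero, coeff_C_mul] at h
    refine (mul_eq_zero.1 ?_).resolve_left (key 1 odd_one)
    rw [← h]
    push_cast
    ring
  | 1 =>
    rw [act_linField_one, map_neg, coeff_C_mul] at h
    refine (mul_eq_zero.1 ?_).resolve_left (key (-1) odd_neg_one)
    rw [← h]
    push_cast
    ring

theorem depthPart_odd {Z : FormalField} (hZ : formalBracket (toFormal linField) Z = 0) (p : ℕ) :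
    depthPart Z (2 * p + 1) = 0 := by
  funext j
  apply MvPowerSeries.ext
  intro e
  change coeff e (homogeneousComponent (2 * p + 1 + 1) (Z j)) = coeff e 0
  rw [coeff_homogeneousComponent, map_zero]
  split_ifs with h
  -- Depth `2p + 1` means degree `2p + 2`, which is even.
  · refine coeff_eq_zero_of_formalBracket_eq_zero hZ j ⟨p + 1, ?_⟩
    rw [Finsupp.degree_eq_sum, Fin.sum_univ_two] at h
    omega
  · rfl

end Formal

/-! ### Bihomogeneous derivations -/

open MvPolynomial

/-- The bidegree of the two variables. -/
def bidegree : Fin 2 → ℤ × ℤ := ![(1, 0), (0, 1)]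

theorem weight_bidegree (e : Fin 2 →₀ ℕ) :
    Finsupp.weight bidegree e = ((e 0 : ℤ), (e 1 : ℤ)) := by
  rw [Finsupp.weight_apply, Finsupp.sum_fintype _ _ (by simp), Fin.sum_univ_two]
  simp [bidegree]

/-- A derivation is bihomogeneous of bidegree `n` when it shifts bidegrees by `n`. -/
def IsBihomogeneous (D : Der) (n : ℤ × ℤ) : Prop :=
  ∀ (F : MvPolynomial (Fin 2) ℂ) (m : ℤ × ℤ), IsWeightedHomogeneous bidegree F m →
    IsWeightedHomogeneous bidegree (D F) (m + n)

theorem toDer_apply (V : PolyField) (F : MvPolynomial (Fin 2) ℂ) :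
    toDer V F = ∑ i, V i * pderiv i F := by
  have : toDer V = ∑ i, V i • (pderiv i : Der) := by
    apply MvPolynomial.derivation_ext
    intro j
    fin_cases j <;> simp [toDer, mkDerivation_X, Derivation.add_apply]
  rw [this]
  simp [Derivation.add_apply]

theorem isWeightedHomogeneous_pderiv {F : MvPolynomial (Fin 2) ℂ} {m : ℤ × ℤ}
    (hF : IsWeightedHomogeneous bidegree F m) (i : Fin 2) :
    IsWeightedHomogeneous bidegree (pderiv i F) (m - bidegree i) := by
  intro e he
  rw [MvPolynomial.coeff_pderiv] at he
  rw [← hF (left_ne_zero_of_mul he), map_add, Finsupp.weight_single, one_smul, add_sub_cancel_right]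

/-- Since `∂ᵢ` lowers the bidegree by that of the `i`-th variable, its coefficient has to restore it
and add `n`. -/
theorem isBihomogeneous_toDer {V : PolyField} {n : ℤ × ℤ}
    (hV : ∀ i, IsWeightedHomogeneous bidegree (V i) (bidegree i + n)) :
    IsBihomogeneous (toDer V) n := by
  intro F m hF
  rw [toDer_apply]
  refine IsWeightedHomogeneous.sum _ _ _ fun i _ => ?_
  have h := (hV i).mul (isWeightedHomogeneous_pderiv hF i)
  rwa [show bidegree i + n + (m - bidegree i) = m + n by abel] at h

theorem IsBihomogeneous.bracket {D E : Der} {n m : ℤ × ℤ} (hD : IsBihomogeneous D n)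
    (hE : IsBihomogeneous E m) : IsBihomogeneous ⁅D, E⁆ (n + m) := by
  intro F k hF
  rw [Derivation.commutator_apply]
  have h₁ := hD _ _ (hE _ _ hF)
  have h₂ := hE _ _ (hD _ _ hF)
  rw [show k + m + n = k + (n + m) by abel] at h₁
  rw [show k + n + m = k + (n + m) by abel] at h₂
  exact h₁.sub h₂

theorem isWeightedHomogeneous_term (F : MvPolynomial (Fin 2) ℂ) (a b : ℤ) :
    IsWeightedHomogeneous bidegree (term F a b) (a, b) := by
  rw [term]
  split_ifs with h
  · apply isWeightedHomogeneous_monomial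
    rw [weight_bidegree]
    simp [expo, h.1, h.2]
  · exact isWeightedHomogeneous_zero _ _ _

theorem isBihomogeneous_B (X : PolyField) (n : Letter) : IsBihomogeneous (B X n) n := by
  refine isBihomogeneous_toDer fun i => ?_
  match i with
  | 0 =>
    have h := isWeightedHomogeneous_term (X 0) (n.1 + 1) n.2
    rwa [show (n.1 + 1, n.2) = bidegree 0 + n by ext <;> simp [bidegree, add_comm]] at h
  | 1 =>
    have h := isWeightedHomogeneous_term (X 1) n.1 (n.2 + 1)
    rwa [show (n.1, n.2 + 1) = bidegree 1 + n by ext <;> simp [bidegree, add_comm]] at h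

theorem isBihomogeneous_foldl (X : PolyField) (w : Word) (D : Der) (n : ℤ × ℤ)
    (hD : IsBihomogeneous D n) :
    IsBihomogeneous (w.foldl (fun D m => ⁅D, B X m⁆) D) (n + w.sum) := by
  induction w generalizing D n with
  | nil => simpa using hD
  | cons m t ih =>
    rw [List.foldl_cons, List.sum_cons, ← add_assoc]
    exact ih _ _ (hD.bracket (isBihomogeneous_B X m))

theorem isBihomogeneous_bracketWord (X : PolyField) (w : Word) :
    IsBihomogeneous (bracketWord X w) w.sum := by
  cases w with
  | nil => exact fun F m _ => isWeightedHomogeneous_zero _ _ _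
  | cons n t =>
    rw [List.sum_cons]
    exact isBihomogeneous_foldl X t _ _ (isBihomogeneous_B X n)

/-- The bidegree of a monomial is its exponent, so each graded piece is at most a line. -/
theorem eq_monomial_of_isWeightedHomogeneous {F : MvPolynomial (Fin 2) ℂ} {a b : ℕ}
    (hF : IsWeightedHomogeneous bidegree F ((a : ℤ), (b : ℤ))) :
    F = C (coeff (expo a b) F) * (X 0 ^ a * X 1 ^ b) := by
  have hm : (X 0 ^ a * X 1 ^ b : MvPolynomial (Fin 2) ℂ) = monomial (expo a b) 1 := by
    rw [X_pow_eq_monomial, X_pow_eq_monomial, monomial_mul, one_mul, expo]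
  rw [hm, C_mul_monomial, mul_one]
  ext e
  rw [coeff_monomial]
  split_ifs with h
  · rw [h]
  · by_contra hne
    have hw := hF hne
    rw [weight_bidegree, Prod.mk.injEq, Nat.cast_inj, Nat.cast_inj] at hw
    apply h
    ext i
    match i with
    | 0 => simp [expo, hw.1]
    | 1 => simp [expo, hw.2]

theorem IsBihomogeneous.eq_resonantDer {D : Der} {m : ℕ}
    (hD : IsBihomogeneous D ((m : ℤ), (m : ℤ))) : ∃ P Q : ℂ, D = resonantDer m P Q := by
  have h₀ : IsWeightedHomogeneous bidegree (D (X 0)) (((m + 1 : ℕ) : ℤ), (m : ℤ)) := by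
    have h := hD _ _ (isWeightedHomogeneous_X ℂ bidegree 0)
    rwa [show bidegree 0 + ((m : ℤ), (m : ℤ)) = (((m + 1 : ℕ) : ℤ), (m : ℤ)) by
      ext <;> simp [bidegree, add_comm]] at h
  have h₁ : IsWeightedHomogeneous bidegree (D (X 1)) ((m : ℤ), ((m + 1 : ℕ) : ℤ)) := by
    have h := hD _ _ (isWeightedHomogeneous_X ℂ bidegree 1)
    rwa [show bidegree 1 + ((m : ℤ), (m : ℤ)) = ((m : ℤ), ((m + 1 : ℕ) : ℤ)) by
      ext <;> simp [bidegree, add_comm]] at h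
  refine ⟨coeff (expo (m + 1) m) (D (X 0)), coeff (expo m (m + 1)) (D (X 1)),
    MvPolynomial.derivation_ext fun i => ?_⟩
  rw [resonantDer, toDer, mkDerivation_X]
  match i with
  | 0 =>
    refine (eq_monomial_of_isWeightedHomogeneous h₀).trans ?_
    change _ = (X 0 * X 1) ^ m * (C _ * X 0)
    ring
  | 1 =>
    refine (eq_monomial_of_isWeightedHomogeneous h₁).trans ?_
    change _ = (X 0 * X 1) ^ m * (C _ * X 1)
    ring

theorem bracketWord_of_isResonant (X : PolyField) {w : Word} (hw : IsWordOf X w)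
    (hres : IsResonant w) :
    ∃ (m : ℕ) (P Q : ℂ), depth w = 2 * (m : ℤ) ∧ bracketWord X w = resonantDer m P Q := by
  have hd := depth_eq w
  have hlen := length_le_depth hw
  rw [isResonant_iff] at hres
  -- Letters may have an entry `-1`, but by resonance twice this sum is the depth, which is at least
  -- the length of the word.
  obtain ⟨m, hm⟩ := Int.eq_ofNat_of_zero_le (a := w.sum.1) (by omega)
  have hB := isBihomogeneous_bracketWord X w
  rw [show w.sum = ((m : ℤ), (m : ℤ)) from Prod.ext hm (hres ▸ hm)] at hB
  obtain ⟨P, Q, hPQ⟩ := hB.eq_resonantDer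
  exact ⟨m, P, Q, by omega, hPQ⟩

end Correction

theorem mainTheorem10 (X : Correction.PolyField) (hlin : Correction.HasLinearPart X)
    (hX : Correction.IsRealHamiltonian X) :
    (∀ p : ℕ, Correction.carr X (2 * p + 1) = 0) ∧
    (∀ Z : Correction.FormalField, Correction.IsCorrection X Z →
      ∀ p : ℕ, Correction.depthPart Z (2 * p + 1) = 0) ∧
    (∀ w : Correction.Word, Correction.IsWordOf X w → Correction.IsResonant w →
      ∃ (m : ℕ) (P Q : ℂ), Correction.depth w = 2 * (m : ℤ) ∧
        Correction.bracketWord X w = Correction.resonantDer m P Q) :=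
  ⟨Correction.carr_odd X, fun _ hZ p => Correction.depthPart_odd hZ.2.2 p,
    fun _ hw hres => Correction.bracketWord_of_isResonant X hw hres⟩
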